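/- Let $n_0,n_1,n_2\ge 1$ be integers and let $G=\theta_{n_0,n_1,n_2}$ be the theta graph obtained by joining two vertices by three paths (strands) of lengths $n_0,n_1,n_2$. For $\alpha\in\{0,1,2\}$ and $0\le i\le n_\alpha$, let $v_{\alpha,i}$ be the vertex at distance $i$ along the $\alpha$-th strand from one fixed of these two vertices, so that $v_{0,0}=v_{1,0}=v_{2,0}$ and $v_{0,n_0}=v_{1,n_1}=v_{2,n_2}$, and all other labels denote distinct vertices. A divisor on $G$ is an integer combination of vertices, $\sim$ denotes linear equivalence (chip-firing equivalence), $\operatorname{Pic}(G)$ is the group of divisor classes, and $r(D)$ is the Baker--Norine rank: the largest integer $r\ge -1$ such that for every effective divisor $F$ of degree $r$ the divisor $D-F$ is linearly equivalent to an effective divisor. Let $u,v$ be vertices of $G$ with $u\not\sim v$, and for a divisor $D$ put $$\Delta(D)=r(D)-r(D-u)-r(D-v)+r(D-u-v).$$ If $u=v_{\alpha,i}$ and $v=v_{\alpha,j}$ lie on a common strand $\alpha$, put $$N_{\alpha,i,j}=\{v_{\alpha,k}: 0\le k\le n_\alpha,\ k\ne n_\alpha-i,\ k\ne j,\ j-i\le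 k\le j-i+n_\alpha\}.$$ 1. There exists a divisor $D$ on $G$ with $\Delta(D)<0$ if and only if there are $\alpha$ and $0\le i,j\le n_\alpha$ such that $u=v_{\alpha,i}$, $v=v_{\alpha,j}$ and $N_{\alpha,i,j}\neq\emptyset$. 2. Whenever $u=v_{\alpha,i}$ and $v=v_{\alpha,j}$ with $0\le i,j\le n_\alpha$, the map $v_{\alpha,k}\mapsto[v_{\alpha,k}+v_{\alpha,i}]$ is a bijection from $N_{\alpha,i,j}$ onto $\{[D]\in\operatorname{Pic}(G):\Delta(D)<0\}$ (both sets being empty if $N_{\alpha,i,j}$ is empty). -/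

import Mathlib

/-- A finite graph, possibly with parallel edges: each edge has two ends. The order in which the
two ends of an edge are listed is auxiliary and plays no role in the notions below. -/
structure Multigraph (V E : Type*) where
  src : E → V
  tgt : E → V

namespace Multigraph

variable {V E : Type*} [Fintype V] [DecidableEq V] [Fintype E]

/-- The degree of a divisor `D : V → ℤ`, that is, of an element of the free abelian group on the
finite vertex set. -/
def deg (D : V → ℤ) : ℤ := ∑ w, D w

/-- The divisor consisting of one chip on the vertex `w`. -/
def chip (w : V) : V → ℤ := Pi.single w 1

/-- The principal divisor of `f : V → ℤ`, i.e. the total effect of firing every vertex `w` exactly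
`f w` times: along each edge, one chip moves from one end to the other for every firing. -/
def principal (G : Multigraph V E) : (V → ℤ) →+ (V → ℤ) where
  toFun f := ∑ e, (f (G.src e) - f (G.tgt e)) • (chip (G.tgt e) - chip (G.src e))
  map_zero' := by simp
  map_add' f h := by
    rw [← Finset.sum_add_distrib]
    refine Finset.sum_congr rfl fun e _ => ?_
    rw [← add_smul, Pi.add_apply, Pi.add_apply]
    congr 1
    ring

/-- Linear equivalence of divisors. -/
def LinEquiv (G : Multigraph V E) (D D' : V → ℤ) : Prop := D - D' ∈ G.principal.range

/-- The Picard group: divisors modulo principal divisors. -/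
abbrev Pic (G : Multigraph V E) : Type _ := (V → ℤ) ⧸ G.principal.range

/-- The class of a divisor in the Picard group. -/
def toPic (G : Multigraph V E) (D : V → ℤ) : G.Pic := QuotientAddGroup.mk D

/-- The complete linear system `|D|` is nonempty. -/
def HasEffective (G : Multigraph V E) (D : V → ℤ) : Prop := ∃ F : V → ℤ, 0 ≤ F ∧ G.LinEquiv D F

/-- The Baker--Norine rank: the largest integer `r ≥ -1` such that `|D - F|` is nonempty for every
effective divisor `F` of degree `r` (there is no such `F` when `r = -1`). The maximum exists by
`isGreatest_rank`. -/
noncomputable def rank (G : Multigraph V E) (D : V → ℤ) : ℤ :=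
  sSup {r : ℤ | -1 ≤ r ∧ ∀ F : V → ℤ, 0 ≤ F → deg F = r → G.HasEffective (D - F)}

theorem deg_principal (G : Multigraph V E) (f : V → ℤ) : deg (G.principal f) = 0 := by
  simp only [deg, principal, AddMonoidHom.coe_mk, ZeroHom.coe_mk, Finset.sum_apply]
  rw [Finset.sum_comm]
  refine Finset.sum_eq_zero fun e _ => ?_
  simp [chip, ← Finset.mul_sum, Finset.sum_sub_distrib]

theorem isGreatest_rank [Nonempty V] (G : Multigraph V E) (D : V → ℤ) :
    IsGreatest {r : ℤ | -1 ≤ r ∧ ∀ F : V → ℤ, 0 ≤ F → deg F = r → G.HasEffective (D - F)}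
      (G.rank D) := by
  have hne : ({r : ℤ | -1 ≤ r ∧ ∀ F : V → ℤ, 0 ≤ F → deg F = r →
      G.HasEffective (D - F)}).Nonempty := by
    refine ⟨-1, le_rfl, fun F hF hd => ?_⟩
    have : 0 ≤ deg F := Finset.sum_nonneg fun w _ => hF w
    omega
  have hbd : BddAbove {r : ℤ | -1 ≤ r ∧ ∀ F : V → ℤ, 0 ≤ F → deg F = r →
      G.HasEffective (D - F)} := by
    refine ⟨max (deg D) 0, fun r hr => ?_⟩
    by_cases h0 : r ≤ 0
    · exact h0.trans (le_max_right _ _)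
    · obtain ⟨w⟩ := ‹Nonempty V›
      obtain ⟨F, hF, f, hf⟩ := hr.2 (Pi.single w r)
        (Pi.single_nonneg.2 (by omega)) (by simp [deg])
      have h1 := G.deg_principal f
      rw [hf] at h1
      have h2 : 0 ≤ deg F := Finset.sum_nonneg fun w _ => hF w
      simp only [deg, Pi.sub_apply, Finset.sum_sub_distrib, Finset.sum_pi_single'] at h1 h2 ⊢
      simp at h1
      refine le_max_of_le_left ?_
      linarith
  exact ⟨Int.csSup_mem hne hbd, fun r hr => le_csSup hbd hr⟩

/-- `Δ(D) = r(D) - r(D - u) - r(D - v) + r(D - u - v)`. -/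
noncomputable def Delta (G : Multigraph V E) (u v : V) (D : V → ℤ) : ℤ :=
  G.rank D - G.rank (D - chip u) - G.rank (D - chip v) + G.rank (D - chip u - chip v)

end Multigraph

/-- The vertices of the theta graph with strands of lengths `n 0, n 1, n 2` (all positive): the two
multivalent vertices `Sum.inl false`, `Sum.inl true`, and on each strand `α` the `n α - 1` interior
vertices. -/
abbrev ThetaVertex (n : Fin 3 → ℕ) : Type := Bool ⊕ (Σ α : Fin 3, Fin (n α - 1))

/-- The vertex `v_{α,k}` at distance `k` from `v_{0,0}` along the strand `α`, for `0 ≤ k ≤ n α`.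
(Only these values of `k` are used.) -/
def thetaVertex (n : Fin 3 → ℕ) (α : Fin 3) (k : ℕ) : ThetaVertex n :=
  if h0 : k = 0 then Sum.inl false
  else if h : k < n α then Sum.inr ⟨α, ⟨k - 1, by omega⟩⟩
  else Sum.inl true

/-- The theta graph: the `k`-th edge of the strand `α`, for `0 ≤ k < n α`, joins `v_{α,k}` and
`v_{α,k+1}`. -/
def thetaGraph (n : Fin 3 → ℕ) : Multigraph (ThetaVertex n) (Σ α : Fin 3, Fin (n α)) where
  src e := thetaVertex n e.1 e.2
  tgt e := thetaVertex n e.1 (e.2 + 1)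

/-- The set of the vertices `v_{α,k}`, `0 ≤ k ≤ n α`, with `k ≠ n α - i`, `k ≠ j` and
`j - i ≤ k ≤ j - i + n α`, attached to the marked vertices `v_{α,i}` and `v_{α,j}`. -/
def nonSubmodularSet (n : Fin 3 → ℕ) (α : Fin 3) (i j : ℕ) : Set (ThetaVertex n) :=
  {w | ∃ k : ℕ, k ≤ n α ∧ w = thetaVertex n α k ∧ (k : ℤ) ≠ n α - i ∧ k ≠ j ∧
    (j : ℤ) - i ≤ k ∧ (k : ℤ) ≤ j - i + n α}

set_option linter.unusedSectionVars false

/-! The theta graph has genus two, so ranks are almost determined by degree: the rank is `deg D - 2`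
from degree 3 on, in degree 2 it is 1 for the canonical class `K` and 0 otherwise, and in lower
degrees it only records effectivity. Going through the degrees, `delta_neg_iff` shows that Δ(D) < 0
happens exactly in degree 2, when D is equivalent neither to K nor to u + v while D - u and D - v
are both effective. Thus D ~ u + x ~ v + y with x ≠ v, and the question is which noncanonical
classes have two such representations.

In the Picard group the difference of consecutive vertices is constant along a strand, and the three
constants add up to zero. Hence two chips on one strand may slide in opposite directions, and three
chips on the three strands may slide together towards `v_{0,0}`. The second move gives effectivity
in degree at least 2 (`hasEffective_of_two_le_deg`), from which the ranks follow.

Conversely, the `moment`, a discrete Abel–Jacobi map, is invariant under equivalence. Integer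
inequalities then show that, outside K, sliding on one strand is the only coincidence between pairs
of vertices (`common_strand_relation`, `interior_ne_common_strand`, `interior_pair_relation`). So u,
x, v, y are `v_{α,i}`, `v_{α,k}`, `v_{α,j}`, `v_{α,l}` with i + k = j + l. The bounds 0 ≤ l ≤ n α,
the exclusion of K (k ≠ n α - i) and x ≠ v (k ≠ j) are the conditions defining `nonSubmodularSet`.
-/

namespace Multigraph

/-! ### Degrees and effective divisors -/

section Divisors

variable {V : Type*} [Fintype V] [DecidableEq V]

@[simp] theorem deg_add (D D' : V → ℤ) : deg (D + D') = deg D + deg D' := by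
  simp [deg, Finset.sum_add_distrib]

@[simp] theorem deg_sub (D D' : V → ℤ) : deg (D - D') = deg D - deg D' := by
  simp [deg, Finset.sum_sub_distrib]

@[simp] theorem deg_zero : deg (0 : V → ℤ) = 0 := by simp [deg]

@[simp] theorem deg_chip (w : V) : deg (chip w) = 1 := by simp [deg, chip]

theorem deg_nonneg {F : V → ℤ} (hF : 0 ≤ F) : 0 ≤ deg F :=
  Finset.sum_nonneg fun w _ => hF w

theorem chip_nonneg (w : V) : 0 ≤ chip w := Pi.single_nonneg.2 zero_le_one

/-- An effective divisor of positive degree contains some vertex. -/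
theorem exists_eq_add_chip {F : V → ℤ} (hF : 0 ≤ F) (hd : 0 < deg F) :
    ∃ (w : V) (F' : V → ℤ), 0 ≤ F' ∧ F = F' + chip w := by
  obtain ⟨w, -, hw⟩ := Finset.exists_lt_of_sum_lt (s := Finset.univ) (f := fun _ => (0 : ℤ)) (g := F)
    (by simpa [deg] using hd)
  refine ⟨w, F - chip w, fun x => ?_, by simp⟩
  have hx := hF x
  rcases eq_or_ne x w with rfl | h
  · simp only [chip, Pi.sub_apply, Pi.single_eq_same, Pi.zero_apply]; omega
  · simpa [chip, h] using hx

theorem eq_zero_of_deg_eq_zero {F : V → ℤ} (hF : 0 ≤ F) (hd : deg F = 0) : F = 0 := by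
  funext w
  exact (Finset.sum_eq_zero_iff_of_nonneg fun w _ => hF w).1 hd w (Finset.mem_univ w)

theorem exists_eq_chip {F : V → ℤ} (hF : 0 ≤ F) (hd : deg F = 1) : ∃ w, F = chip w := by
  obtain ⟨w, F', hF', rfl⟩ := exists_eq_add_chip hF (by omega)
  have : F' = 0 := eq_zero_of_deg_eq_zero hF' (by simpa using hd)
  exact ⟨w, by simp [this]⟩

end Divisors

/-! ### Linear equivalence and effective classes -/

variable {V E : Type*} [Fintype V] [DecidableEq V] [Fintype E] (G : Multigraph V E)

@[simp] theorem toPic_add (D D' : V → ℤ) : G.toPic (D + D') = G.toPic D + G.toPic D' := rfl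

@[simp] theorem toPic_sub (D D' : V → ℤ) : G.toPic (D - D') = G.toPic D - G.toPic D' := rfl

@[simp] theorem toPic_zero : G.toPic 0 = 0 := rfl

theorem toPic_principal (f : V → ℤ) : G.toPic (G.principal f) = 0 :=
  (QuotientAddGroup.eq_zero_iff _).2 ⟨f, rfl⟩

variable {G}

theorem linEquiv_iff {D D' : V → ℤ} : G.LinEquiv D D' ↔ G.toPic D = G.toPic D' := by
  rw [← sub_eq_zero, ← toPic_sub]
  exact (QuotientAddGroup.eq_zero_iff _).symm

theorem deg_eq_of_toPic_eq {D D' : V → ℤ} (h : G.toPic D = G.toPic D') : deg D = deg D' := by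
  obtain ⟨f, hf⟩ := linEquiv_iff.2 h
  have := G.deg_principal f
  rw [hf, deg_sub] at this
  omega

theorem hasEffective_iff {D : V → ℤ} :
    G.HasEffective D ↔ ∃ F : V → ℤ, 0 ≤ F ∧ G.toPic D = G.toPic F := by
  simp only [HasEffective, linEquiv_iff]

theorem hasEffective_congr {D D' : V → ℤ} (h : G.toPic D = G.toPic D') :
    G.HasEffective D ↔ G.HasEffective D' := by
  rw [hasEffective_iff, hasEffective_iff, h]

theorem HasEffective.of_nonneg {D : V → ℤ} (h : 0 ≤ D) : G.HasEffective D :=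
  hasEffective_iff.2 ⟨D, h, rfl⟩

theorem HasEffective.add {D D' : V → ℤ} (h : G.HasEffective D) (h' : G.HasEffective D') :
    G.HasEffective (D + D') := by
  obtain ⟨F, hF, e⟩ := hasEffective_iff.1 h
  obtain ⟨F', hF', e'⟩ := hasEffective_iff.1 h'
  exact hasEffective_iff.2 ⟨F + F', add_nonneg hF hF', by simp [e, e']⟩

theorem HasEffective.deg_nonneg {D : V → ℤ} (h : G.HasEffective D) : 0 ≤ deg D := by
  obtain ⟨F, hF, e⟩ := hasEffective_iff.1 h
  rw [deg_eq_of_toPic_eq e]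
  exact Multigraph.deg_nonneg hF

theorem HasEffective.toPic_eq_zero {D : V → ℤ} (h : G.HasEffective D) (hd : deg D = 0) :
    G.toPic D = 0 := by
  obtain ⟨F, hF, e⟩ := hasEffective_iff.1 h
  rw [e, eq_zero_of_deg_eq_zero hF ((deg_eq_of_toPic_eq e).symm.trans hd), toPic_zero]

theorem HasEffective.exists_chip {D : V → ℤ} (h : G.HasEffective D) (hd : deg D = 1) :
    ∃ w, G.toPic D = G.toPic (chip w) := by
  obtain ⟨F, hF, e⟩ := hasEffective_iff.1 h
  obtain ⟨w, rfl⟩ := exists_eq_chip hF ((deg_eq_of_toPic_eq e).symm.trans hd)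
  exact ⟨w, e⟩

/-! ### The rank on an arbitrary multigraph -/

section Rank

variable [Nonempty V]

theorem neg_one_le_rank (D : V → ℤ) : -1 ≤ G.rank D := (G.isGreatest_rank D).1.1

/-- If `r(D) ≥ r ≥ 0`, subtracting an effective divisor of degree `r` leaves an effective class. -/
theorem hasEffective_sub_of_le_rank {D F : V → ℤ} (hF : 0 ≤ F) (h : deg F ≤ G.rank D) :
    G.HasEffective (D - F) := by
  obtain ⟨w⟩ := ‹Nonempty V›
  -- Pad `F` with chips on `w` to reach degree exactly `r(D)`; the padding is added back afterwards.
  have h0 : (0 : V → ℤ) ≤ Pi.single w (G.rank D - deg F) := Pi.single_nonneg.2 (by omega)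
  have h1 := (G.isGreatest_rank D).1.2 (F + Pi.single w (G.rank D - deg F)) (add_nonneg hF h0)
    (by rw [deg_add]; simp [deg])
  have h2 := h1.add (HasEffective.of_nonneg (G := G) h0)
  rwa [← sub_sub, sub_add_cancel] at h2

theorem le_rank {D : V → ℤ} {r : ℤ} (hr : -1 ≤ r)
    (h : ∀ F : V → ℤ, 0 ≤ F → deg F = r → G.HasEffective (D - F)) : r ≤ G.rank D :=
  (G.isGreatest_rank D).2 ⟨hr, h⟩

theorem rank_nonneg_iff {D : V → ℤ} : 0 ≤ G.rank D ↔ G.HasEffective D := by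
  constructor
  · intro h
    simpa using hasEffective_sub_of_le_rank (G := G) (D := D) (F := 0) le_rfl (by simpa using h)
  · intro h
    refine le_rank (by omega) fun F hF hd => ?_
    rwa [eq_zero_of_deg_eq_zero hF hd, sub_zero]

theorem rank_eq_neg_one {D : V → ℤ} (h : ¬ G.HasEffective D) : G.rank D = -1 := by
  have h1 := neg_one_le_rank (G := G) D
  rw [← rank_nonneg_iff] at h
  omega

theorem rank_of_deg_neg {D : V → ℤ} (h : deg D < 0) : G.rank D = -1 :=
  rank_eq_neg_one fun h' => by have := h'.deg_nonneg; omega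

theorem rank_of_deg_eq_zero {D : V → ℤ} (h : deg D = 0) :
    G.rank D = 0 ∧ G.toPic D = 0 ∨ G.rank D = -1 ∧ G.toPic D ≠ 0 := by
  by_cases h0 : G.toPic D = 0
  · refine Or.inl ⟨le_antisymm ?_ ?_, h0⟩
    · by_contra! h1
      obtain ⟨w⟩ := ‹Nonempty V›
      have := (hasEffective_sub_of_le_rank (G := G) (chip_nonneg w)
        (by simp; omega : deg (chip w) ≤ G.rank D)).deg_nonneg
      simp [h] at this
    · exact rank_nonneg_iff.2 (hasEffective_iff.2 ⟨0, le_rfl, h0⟩)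
  · exact Or.inr ⟨rank_eq_neg_one fun h' => h0 (h'.toPic_eq_zero h), h0⟩

end Rank

end Multigraph

namespace ThetaGraph

open Multigraph

variable {n : Fin 3 → ℕ}

/-! ### Vertex labels on the theta graph -/

theorem thetaVertex_zero (α : Fin 3) : thetaVertex n α 0 = Sum.inl false := by simp [thetaVertex]

theorem thetaVertex_last (hn : ∀ α, 0 < n α) (α : Fin 3) :
    thetaVertex n α (n α) = Sum.inl true := by
  simp [thetaVertex, (hn α).ne']

theorem thetaVertex_interior {α : Fin 3} {k : ℕ} (h0 : 0 < k) (h : k < n α) :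
    thetaVertex n α k = Sum.inr ⟨α, ⟨k - 1, by omega⟩⟩ := by
  simp [thetaVertex, h0.ne', h]

theorem exists_eq_thetaVertex (hn : ∀ α, 0 < n α) (w : ThetaVertex n) :
    ∃ α k, k ≤ n α ∧ w = thetaVertex n α k := by
  rcases w with (_ | _) | ⟨α, k, hk⟩
  · exact ⟨0, 0, Nat.zero_le _, (thetaVertex_zero 0).symm⟩
  · exact ⟨0, n 0, le_rfl, (thetaVertex_last hn 0).symm⟩
  · refine ⟨α, k + 1, by omega, ?_⟩
    rw [thetaVertex_interior (by omega) (by omega)]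
    simp

/-- Two labels of one vertex agree, or are both `0`, or are both the last ones of their strands. -/
theorem thetaVertex_eq_iff (hn : ∀ α, 0 < n α) {α β : Fin 3} {k l : ℕ} (hk : k ≤ n α)
    (hl : l ≤ n β) : thetaVertex n α k = thetaVertex n β l ↔
      α = β ∧ k = l ∨ k = 0 ∧ l = 0 ∨ k = n α ∧ l = n β := by
  have h1 := hn α
  have h2 := hn β
  constructor
  · intro h
    unfold thetaVertex at h
    split_ifs at h
    all_goals first
      | omega
      | (simp only [Sum.inr.injEq, Sigma.mk.injEq] at h
         obtain ⟨rfl, h⟩ := h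
         simp only [heq_eq_eq, Fin.mk.injEq] at h
         omega)
      | simp at h
  · rintro (⟨rfl, rfl⟩ | ⟨rfl, rfl⟩ | ⟨rfl, rfl⟩)
    · rfl
    · rw [thetaVertex_zero, thetaVertex_zero]
    · rw [thetaVertex_last hn, thetaVertex_last hn]

theorem thetaVertex_injOn {α : Fin 3} (hn : ∀ α, 0 < n α) {k l : ℕ} (hk : k ≤ n α)
    (hl : l ≤ n α) (h : thetaVertex n α k = thetaVertex n α l) : k = l := by
  have := (thetaVertex_eq_iff hn hk hl).1 h
  omega

/-! ### Relations between vertex classes in the Picard group -/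

/-- Serves twice: the quotient map to the Picard group yields the relations between vertex classes,
and `moment` yields the invariance of moments. -/
theorem map_principal {A : Type*} [AddCommGroup A] (φ : (ThetaVertex n → ℤ) →+ A)
    (f : ThetaVertex n → ℤ) : φ ((thetaGraph n).principal f) =
      ∑ α, ∑ m ∈ Finset.range (n α), (f (thetaVertex n α m) - f (thetaVertex n α (m + 1))) •
        (φ (chip (thetaVertex n α (m + 1))) - φ (chip (thetaVertex n α m))) := by
  simp only [principal, AddMonoidHom.coe_mk, ZeroHom.coe_mk, map_sum, map_zsmul, map_sub]
  rw [Fintype.sum_sigma]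
  refine Finset.sum_congr rfl fun α _ => ?_
  rw [← Fin.sum_univ_eq_sum_range (fun m => (f (thetaVertex n α m) - f (thetaVertex n α (m + 1))) •
    (φ (chip (thetaVertex n α (m + 1))) - φ (chip (thetaVertex n α m))))]
  rfl

/-- The class of the vertex `v_{α,k}`. -/
noncomputable abbrev vertexClass (n : Fin 3 → ℕ) (α : Fin 3) (k : ℕ) : (thetaGraph n).Pic :=
  (thetaGraph n).toPic (chip (thetaVertex n α k))

theorem sum_smul_vertexClass (f : ThetaVertex n → ℤ) :
    ∑ α, ∑ m ∈ Finset.range (n α), (f (thetaVertex n α m) - f (thetaVertex n α (m + 1))) •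
        (vertexClass n α (m + 1) - vertexClass n α m) = 0 := by
  rw [← (thetaGraph n).toPic_principal f]
  exact (map_principal (QuotientAddGroup.mk' _) f).symm

theorem chip_apply {V : Type*} [DecidableEq V] (w x : V) : chip w x = if x = w then 1 else 0 := by
  simp [chip, Pi.single_apply]

/-- Fire the interior vertex `v_{α,k+1}` once: only its two incident edges contribute. -/
theorem vertexClass_succ_sub (hn : ∀ α, 0 < n α) {α : Fin 3} {k : ℕ} (hk : k + 1 < n α) :
    vertexClass n α (k + 2) - vertexClass n α (k + 1) =
      vertexClass n α (k + 1) - vertexClass n α k := by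
  have h := sum_smul_vertexClass (chip (thetaVertex n α (k + 1)))
  have h1 : ∀ β : Fin 3, ∀ m ≤ n β, chip (thetaVertex n α (k + 1)) (thetaVertex n β m) =
      if β = α ∧ m = k + 1 then (1 : ℤ) else 0 := by
    intro β m hm
    rw [chip_apply]
    congr 1
    rw [thetaVertex_eq_iff hn hm hk.le]
    simp only [eq_iff_iff]
    omega
  rw [Finset.sum_eq_single α, Finset.sum_eq_add_of_mem k (k + 1)] at h
  · rw [h1 _ _ (by omega), h1 _ _ (by omega), h1 _ _ (by omega)] at h
    simp at h
    rw [← sub_eq_zero, ← h]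
    abel
  · simp; omega
  · simpa using hk
  · omega
  · rintro m hm ⟨h2, h3⟩
    have hm := Finset.mem_range.1 hm
    rw [h1 _ _ hm.le, h1 _ _ (by omega)]
    simp [h2, h3]
  · intro β _ hβ
    refine Finset.sum_eq_zero fun m hm => ?_
    have hm := Finset.mem_range.1 hm
    rw [h1 _ _ hm.le, h1 _ _ (by omega)]
    simp [hβ]
  · simp

/-- The difference of the first two vertices along the strand `α`, in the Picard group. -/
noncomputable def strandClass (n : Fin 3 → ℕ) (α : Fin 3) : (thetaGraph n).Pic :=
  vertexClass n α 1 - vertexClass n α 0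

theorem vertexClass_eq (hn : ∀ α, 0 < n α) {α : Fin 3} {k : ℕ} (hk : k ≤ n α) :
    vertexClass n α k = (thetaGraph n).toPic (chip (Sum.inl false)) + (k : ℤ) • strandClass n α := by
  have h : ∀ k, k + 1 ≤ n α → vertexClass n α (k + 1) - vertexClass n α k = strandClass n α := by
    intro k
    induction k with
    | zero => intro _; rfl
    | succ k ih =>
      intro hk
      rw [vertexClass_succ_sub hn (by omega), ih (by omega)]
  induction k with
  | zero => simp [vertexClass, thetaVertex_zero]
  | succ k ih =>
    rw [← sub_add_cancel (vertexClass n α (k + 1)) (vertexClass n α k), h k hk, ih (by omega)]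
    push_cast
    rw [add_zsmul, one_zsmul]
    abel

/-- Fire `v_{0,0}` once: it sends one chip along the first edge of each strand. -/
theorem sum_strandClass (hn : ∀ α, 0 < n α) :
    strandClass n 0 + strandClass n 1 + strandClass n 2 = 0 := by
  have h := sum_smul_vertexClass (n := n) (chip (Sum.inl false))
  have h1 : ∀ β : Fin 3, ∀ m ≤ n β, chip (Sum.inl false) (thetaVertex n β m) =
      if m = 0 then (1 : ℤ) else 0 := by
    intro β m hm
    rw [chip_apply]
    congr 1
    rw [← thetaVertex_zero β, thetaVertex_eq_iff hn hm (Nat.zero_le _)]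
    have := hn β
    simp only [eq_iff_iff, true_and]
    omega
  rw [← Fin.sum_univ_three, ← h]
  refine Finset.sum_congr rfl fun β _ => ?_
  rw [Finset.sum_eq_single_of_mem 0 (by simpa using hn β)]
  · rw [h1 _ _ (Nat.zero_le _), h1 _ _ (hn β)]
    simp [strandClass]
  · intro m hm h0
    have hm := Finset.mem_range.1 hm
    rw [h1 _ _ hm.le, h1 _ _ (by omega)]
    simp [h0]

/-! ### The moment, an invariant of linear equivalence -/

/-- The relations between the moments of linearly equivalent divisors. -/
def momentRelations (n : Fin 3 → ℕ) : AddSubgroup (Fin 3 → ℤ) where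
  -- The term `s` accounts for firing, which shifts all three coordinates equally; the `c α` account
  -- for the last vertex, whose distance `n α` may be recorded on any strand.
  carrier := {w | ∃ (s : ℤ) (c : Fin 3 → ℤ), c 0 + c 1 + c 2 = 0 ∧ ∀ α, w α = s + c α * n α}
  zero_mem' := ⟨0, 0, by simp⟩
  add_mem' := by
    rintro w w' ⟨s, c, h, hw⟩ ⟨s', c', h', hw'⟩
    refine ⟨s + s', c + c', by simp only [Pi.add_apply]; omega, fun α => ?_⟩
    rw [Pi.add_apply, hw, hw', Pi.add_apply]
    ring
  neg_mem' := by
    rintro w ⟨s, c, h, hw⟩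
    refine ⟨-s, -c, by simp only [Pi.neg_apply]; omega, fun α => ?_⟩
    rw [Pi.neg_apply, hw, Pi.neg_apply]
    ring

/-- The moment of a vertex: its distance from `v_{0,0}`, placed in the coordinate of its strand. -/
def vertexMoment (n : Fin 3 → ℕ) : ThetaVertex n → Fin 3 → ℤ
  | Sum.inl false => 0
  -- Coordinate 0 is an arbitrary choice, immaterial modulo the relations by `mk_single_last`.
  | Sum.inl true => Pi.single 0 (n 0)
  | Sum.inr ⟨α, k⟩ => Pi.single α (k + 1)

/-- The moment of a divisor, modulo the relations. -/
def moment (n : Fin 3 → ℕ) : (ThetaVertex n → ℤ) →+ (Fin 3 → ℤ) ⧸ momentRelations n :=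
  (QuotientAddGroup.mk' _).comp
    { toFun := fun D => ∑ w, D w • vertexMoment n w
      map_zero' := by simp
      map_add' := fun D D' => by simp only [Pi.add_apply, add_smul, Finset.sum_add_distrib] }

theorem mk_single_last (α β : Fin 3) :
    ((Pi.single α (n α) : Fin 3 → ℤ) : (Fin 3 → ℤ) ⧸ momentRelations n) =
      ((Pi.single β (n β) : Fin 3 → ℤ) : (Fin 3 → ℤ) ⧸ momentRelations n) := by
  rw [QuotientAddGroup.eq]
  refine ⟨0, Pi.single β 1 - Pi.single α 1, ?_, fun γ => ?_⟩
  · fin_cases α <;> fin_cases β <;> simp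
  · simp only [Pi.add_apply, Pi.neg_apply, Pi.sub_apply, Pi.single_apply]
    split_ifs <;> subst_vars <;> simp

theorem moment_chip (hn : ∀ α, 0 < n α) {α : Fin 3} {k : ℕ} (hk : k ≤ n α) :
    moment n (chip (thetaVertex n α k)) = ((Pi.single α (k : ℤ) : Fin 3 → ℤ) :) := by
  have h1 : moment n (chip (thetaVertex n α k)) = (vertexMoment n (thetaVertex n α k) :) := by
    have h2 : ∑ w, chip (thetaVertex n α k) w • vertexMoment n w =
        vertexMoment n (thetaVertex n α k) := by
      simp only [chip_apply, ite_smul, one_smul, zero_smul, Finset.sum_ite_eq', Finset.mem_univ,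
        if_true]
    exact congrArg _ h2
  rw [h1]
  rcases Nat.eq_zero_or_pos k with rfl | h0
  · simp [thetaVertex_zero, vertexMoment]
  rcases hk.lt_or_eq with hk | rfl
  · rw [thetaVertex_interior h0 hk]
    simp only [vertexMoment]
    rw [Nat.cast_pred h0, sub_add_cancel]
  · rw [thetaVertex_last hn]
    exact mk_single_last 0 α

theorem sum_zsmul_const {A ι : Type*} [AddCommGroup A] (t : Finset ι) (c : ι → ℤ) (x : A) :
    (∑ m ∈ t, c m) • x = ∑ m ∈ t, c m • x :=
  Finset.sum_smul

/-- Every edge of strand α has as moment the unit vector of α, so the firing coefficients telescope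
to the difference of `f` at the two ends. This difference is the same for all strands, and the
vector (1, 1, 1) is the relation with `s = 1`, `c = 0`. -/
theorem moment_principal (hn : ∀ α, 0 < n α) (f : ThetaVertex n → ℤ) :
    moment n ((thetaGraph n).principal f) = 0 := by
  have h : ∀ α, ∑ m ∈ Finset.range (n α), (f (thetaVertex n α m) - f (thetaVertex n α (m + 1))) •
      (moment n (chip (thetaVertex n α (m + 1))) - moment n (chip (thetaVertex n α m))) =
      (f (Sum.inl false) - f (Sum.inl true)) •
        ((Pi.single α 1 : Fin 3 → ℤ) : (Fin 3 → ℤ) ⧸ momentRelations n) := by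
    intro α
    have h1 := Finset.sum_range_sub' (fun m => f (thetaVertex n α m)) (n α)
    rw [← thetaVertex_zero α, ← thetaVertex_last hn α, ← h1, sum_zsmul_const]
    refine Finset.sum_congr rfl fun m hm => ?_
    have hm := Finset.mem_range.1 hm
    rw [moment_chip hn hm, moment_chip hn hm.le, ← QuotientAddGroup.mk_sub, ← Pi.single_sub]
    push_cast
    rw [add_sub_cancel_left]
  rw [map_principal, Finset.sum_congr rfl fun α _ => h α, Finset.sum_zsmul, Fin.sum_univ_three,
    ← QuotientAddGroup.mk_add, ← QuotientAddGroup.mk_add, (QuotientAddGroup.eq_zero_iff _).2,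
    zsmul_zero]
  refine ⟨1, 0, by simp, fun α => ?_⟩
  fin_cases α <;> simp

theorem moment_eq_of_toPic_eq (hn : ∀ α, 0 < n α) {D D' : ThetaVertex n → ℤ}
    (h : (thetaGraph n).toPic D = (thetaGraph n).toPic D') : moment n D = moment n D' := by
  obtain ⟨f, hf⟩ := linEquiv_iff.2 h
  rw [← sub_eq_zero, ← map_sub, ← hf, moment_principal hn]

/-- The moments of linearly equivalent sums of two vertices differ by a relation. -/
theorem moment_relation (hn : ∀ α, 0 < n α) {α β γ δ : Fin 3} {i k j l : ℕ} (hi : i ≤ n α)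
    (hk : k ≤ n β) (hj : j ≤ n γ) (hl : l ≤ n δ)
    (h : vertexClass n α i + vertexClass n β k = vertexClass n γ j + vertexClass n δ l) :
    (Pi.single α (i : ℤ) + Pi.single β (k : ℤ)) - (Pi.single γ (j : ℤ) + Pi.single δ (l : ℤ)) ∈
      momentRelations n := by
  have h1 := moment_eq_of_toPic_eq hn (D := chip (thetaVertex n α i) + chip (thetaVertex n β k))
    (D' := chip (thetaVertex n γ j) + chip (thetaVertex n δ l)) h
  rw [map_add, map_add, moment_chip hn hi, moment_chip hn hk, moment_chip hn hj,
    moment_chip hn hl] at h1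
  rw [← QuotientAddGroup.eq_zero_iff, QuotientAddGroup.mk_sub, QuotientAddGroup.mk_add,
    QuotientAddGroup.mk_add, h1, sub_self]

/-! ### Integer arithmetic of the moment relations -/

theorem exists_third (α β : Fin 3) (h : α ≠ β) : ∃ γ, γ ≠ α ∧ γ ≠ β := by
  revert α β; decide

theorem sum_fin_three {M : Type*} [AddCommMonoid M] {α β γ : Fin 3} (h : α ≠ β) (h' : γ ≠ α)
    (h'' : γ ≠ β) (c : Fin 3 → M) : ∑ δ, c δ = c α + c β + c γ := by
  have h1 : (Finset.univ : Finset (Fin 3)) = {α, β, γ} := by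
    revert α β γ; decide
  rw [h1, Finset.sum_insert (by simp [h, h'.symm]), Finset.sum_pair h''.symm, add_assoc]

/-- Replaces a product by linear information, so that it can be generalized to a variable before
calling `omega`; coefficients beyond ±2 need not be distinguished. -/
theorem mul_cases (c : ℤ) {m : ℤ} (hm : 0 < m) :
    c ≤ -2 ∧ c * m ≤ -2 * m ∨ c = -1 ∧ c * m = -m ∨ c = 0 ∧ c * m = 0 ∨ c = 1 ∧ c * m = m ∨
      2 ≤ c ∧ 2 * m ≤ c * m := by
  rcases (by omega : c ≤ -2 ∨ c = -1 ∨ c = 0 ∨ c = 1 ∨ 2 ≤ c) with h | h | h | h | h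
  · exact Or.inl ⟨h, mul_le_mul_of_nonneg_right h hm.le⟩
  · simp [h]
  · simp [h]
  · simp [h]
  · exact Or.inr (Or.inr (Or.inr (Or.inr ⟨h, mul_le_mul_of_nonneg_right h hm.le⟩)))

/-- Relations written in the order `α, β, γ` of the coordinates. -/
theorem exists_of_mem_momentRelations {w : Fin 3 → ℤ} (hw : w ∈ momentRelations n)
    {α β γ : Fin 3} (h : α ≠ β) (h' : γ ≠ α) (h'' : γ ≠ β) :
    ∃ s a b c : ℤ, a + b + c = 0 ∧ w α = s + a * n α ∧ w β = s + b * n β ∧ w γ = s + c * n γ := by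
  obtain ⟨s, c, hc, hw⟩ := hw
  refine ⟨s, c α, c β, c γ, ?_, hw α, hw β, hw γ⟩
  rw [← sum_fin_three h h' h'', Fin.sum_univ_three, hc]

/-- If `s ≠ 0`, the ranges fix the sign of two of the coefficients; as all three sum to zero, the
third has absolute value at least 2 and pushes its coordinate out of range. If `s = 0` and α ≠ β,
the third strand has coefficient 0 and a = -b ∈ {0, 1, 2} gives the last three alternatives. -/
theorem single_sub_single_relation (hn : ∀ α, 0 < n α) {α β : Fin 3} {t u : ℤ} (ht : 0 ≤ t)
    (ht' : t ≤ 2 * n α) (hu : 0 ≤ u) (hu' : u ≤ 2 * n β)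
    (h : Pi.single α t - Pi.single β u ∈ momentRelations n) :
    α = β ∧ t = u ∨ t = 0 ∧ u = 0 ∨ t = n α ∧ u = n β ∨ t = 2 * n α ∧ u = 2 * n β := by
  by_cases hab : α = β
  · subst hab
    obtain ⟨β, hb⟩ := exists_ne α
    obtain ⟨γ, h', h''⟩ := exists_third α β hb.symm
    obtain ⟨s, a, b, c, h0, e1, e2, e3⟩ := exists_of_mem_momentRelations h hb.symm h' h''
    simp [hb, h'] at e1 e2 e3
    have p1 := mul_cases a (m := n α) (by exact_mod_cast hn α)
    have p2 := mul_cases b (m := n β) (by exact_mod_cast hn β)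
    have p3 := mul_cases c (m := n γ) (by exact_mod_cast hn γ)
    have := hn α
    have := hn β
    have := hn γ
    generalize a * (n α : ℤ) = p at *
    generalize b * (n β : ℤ) = q at *
    generalize c * (n γ : ℤ) = r at *
    refine Or.inl ⟨rfl, ?_⟩
    rcases lt_trichotomy s 0 with hs | hs | hs <;> omega
  · obtain ⟨γ, h', h''⟩ := exists_third α β hab
    obtain ⟨s, a, b, c, h0, e1, e2, e3⟩ := exists_of_mem_momentRelations h hab h' h''
    simp [hab, Ne.symm hab, h', h''] at e1 e2 e3
    have p1 := mul_cases a (m := n α) (by exact_mod_cast hn α)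
    have p2 := mul_cases b (m := n β) (by exact_mod_cast hn β)
    have p3 := mul_cases c (m := n γ) (by exact_mod_cast hn γ)
    have := hn α
    have := hn β
    have := hn γ
    generalize a * (n α : ℤ) = p at *
    generalize b * (n β : ℤ) = q at *
    generalize c * (n γ : ℤ) = r at *
    rcases lt_trichotomy s 0 with hs | hs | hs
    · omega
    · rcases p3 with p3 | p3 | p3 | p3 | p3 <;> omega
    · omega

/-- A pair interior to two strands is never equivalent to a pair on a common strand, whose moment is
a single entry `t`. If `s = 0`, an interior distance would be a multiple of its strand length; if `s
≠ 0`, the ranges are incompatible with coefficients of sum zero. -/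
theorem interior_pair_not_relation (hn : ∀ α, 0 < n α) {α β γ : Fin 3} {k l t : ℤ}
    (hab : α ≠ β) (hk : 0 < k) (hk' : k < n α) (hl : 0 < l) (hl' : l < n β) (ht : 0 ≤ t)
    (ht' : t ≤ 2 * n γ) :
    (Pi.single α k + Pi.single β l) - Pi.single γ t ∉ momentRelations n := by
  intro h
  -- The strand γ differs from α or from β; by symmetry let it differ from β.
  wlog hbc : γ ≠ β generalizing α β k l
  · simp only [ne_eq, not_not] at hbc
    exact this hab.symm hl hl' hk hk' (by rwa [add_comm]) (by rw [hbc]; exact hab.symm)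
  by_cases hac : γ = α
  · subst hac
    obtain ⟨δ, h', h''⟩ := exists_third γ β hab
    obtain ⟨s, a, b, c, h0, e1, e2, e3⟩ := exists_of_mem_momentRelations h hab h' h''
    simp [hab, Ne.symm hab, h', h''] at e1 e2 e3
    have p1 := mul_cases a (m := n γ) (by exact_mod_cast hn γ)
    have p2 := mul_cases b (m := n β) (by exact_mod_cast hn β)
    have p3 := mul_cases c (m := n δ) (by exact_mod_cast hn δ)
    have := hn δ
    generalize a * (n γ : ℤ) = p at *
    generalize b * (n β : ℤ) = q at *
    generalize c * (n δ : ℤ) = r at *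
    rcases lt_trichotomy s 0 with hs | hs | hs <;> omega
  · obtain ⟨s, a, b, c, h0, e1, e2, e3⟩ := exists_of_mem_momentRelations h hab hac hbc
    simp [hab, Ne.symm hab, hac, hbc, Ne.symm hac, Ne.symm hbc] at e1 e2 e3
    have p1 := mul_cases a (m := n α) (by exact_mod_cast hn α)
    have p2 := mul_cases b (m := n β) (by exact_mod_cast hn β)
    have p3 := mul_cases c (m := n γ) (by exact_mod_cast hn γ)
    have := hn γ
    generalize a * (n α : ℤ) = p at *
    generalize b * (n β : ℤ) = q at *
    generalize c * (n γ : ℤ) = r at *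
    rcases lt_trichotomy s 0 with hs | hs | hs <;> omega

/-- The differences `k - k'` and `l - l'` are shorter than their strands, so `s > 0` makes their
coefficients nonpositive and the third negative, contradicting sum zero; `s < 0` is symmetric, and
`s = 0` makes every coefficient vanish. -/
theorem interior_pair_same_strands (hn : ∀ α, 0 < n α) {α β : Fin 3} {k l k' l' : ℤ}
    (hab : α ≠ β) (hk : 0 < k) (hkn : k < n α) (hl : 0 < l) (hln : l < n β)
    (hk' : 0 < k') (hkn' : k' < n α) (hl' : 0 < l') (hln' : l' < n β)
    (h : (Pi.single α k + Pi.single β l) - (Pi.single α k' + Pi.single β l') ∈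
      momentRelations n) : k = k' ∧ l = l' := by
  obtain ⟨γ, h', h''⟩ := exists_third α β hab
  obtain ⟨s, a, b, c, h0, e1, e2, e3⟩ := exists_of_mem_momentRelations h hab h' h''
  simp [hab, Ne.symm hab, h', h''] at e1 e2 e3
  have p1 := mul_cases a (m := n α) (by exact_mod_cast hn α)
  have p2 := mul_cases b (m := n β) (by exact_mod_cast hn β)
  have p3 := mul_cases c (m := n γ) (by exact_mod_cast hn γ)
  have := hn γ
  generalize a * (n α : ℤ) = p at *
  generalize b * (n β : ℤ) = q at *
  generalize c * (n γ : ℤ) = r at *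
  rcases lt_trichotomy s 0 with hs | hs | hs <;> omega

theorem interior_pair_other_strand (hn : ∀ α, 0 < n α) {α β γ : Fin 3} {k l k' l' : ℤ}
    (hab : α ≠ β) (hac : γ ≠ α) (hbc : γ ≠ β) (hk : 0 < k) (hkn : k < n α) (hl : 0 < l)
    (hln : l < n β) (hk' : 0 < k') (hkn' : k' < n α) (hl' : 0 < l') (hln' : l' < n γ) :
    (Pi.single α k + Pi.single β l) - (Pi.single α k' + Pi.single γ l') ∉ momentRelations n := by
  intro h
  obtain ⟨s, a, b, c, h0, e1, e2, e3⟩ := exists_of_mem_momentRelations h hab hac hbc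
  simp [hab, Ne.symm hab, hac, hbc, Ne.symm hac, Ne.symm hbc] at e1 e2 e3
  have p1 := mul_cases a (m := n α) (by exact_mod_cast hn α)
  have p2 := mul_cases b (m := n β) (by exact_mod_cast hn β)
  have p3 := mul_cases c (m := n γ) (by exact_mod_cast hn γ)
  generalize a * (n α : ℤ) = p at *
  generalize b * (n β : ℤ) = q at *
  generalize c * (n γ : ℤ) = r at *
  rcases lt_trichotomy s 0 with hs | hs | hs <;> omega

theorem interior_pair_relation (hn : ∀ α, 0 < n α) {α β γ δ : Fin 3} {k l k' l' : ℤ}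
    (hab : α ≠ β) (hcd : γ ≠ δ) (hk : 0 < k) (hkn : k < n α) (hl : 0 < l) (hln : l < n β)
    (hk' : 0 < k') (hkn' : k' < n γ) (hl' : 0 < l') (hln' : l' < n δ)
    (h : (Pi.single α k + Pi.single β l) - (Pi.single γ k' + Pi.single δ l') ∈
      momentRelations n) :
    (α = γ ∧ k = k' ∧ β = δ ∧ l = l') ∨ (α = δ ∧ k = l' ∧ β = γ ∧ l = k') := by
  by_cases h1 : γ = α
  · subst h1
    by_cases h2 : δ = β
    · subst h2
      have := interior_pair_same_strands hn hab hk hkn hl hln hk' hkn' hl' hln' h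
      exact Or.inl ⟨rfl, this.1, rfl, this.2⟩
    · exact absurd h (interior_pair_other_strand hn hab hcd.symm h2 hk hkn hl hln hk' hkn' hl' hln')
  by_cases h2 : δ = β
  · subst h2
    rw [add_comm (Pi.single α k : Fin 3 → ℤ), add_comm (Pi.single γ k' : Fin 3 → ℤ)] at h
    exact absurd h
      (interior_pair_other_strand hn hab.symm hcd h1 hl hln hk hkn hl' hln' hk' hkn')
  by_cases h3 : δ = α
  · subst h3
    rw [add_comm (Pi.single γ k' : Fin 3 → ℤ)] at h
    by_cases h4 : γ = β
    · subst h4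
      have := interior_pair_same_strands hn hab hk hkn hl hln hl' hln' hk' hkn' h
      exact Or.inr ⟨rfl, this.1, rfl, this.2⟩
    · exact absurd h (interior_pair_other_strand hn hab hcd h4 hk hkn hl hln hl' hln' hk' hkn')
  -- There are only three strands, so two pairs of distinct strands share one.
  have h4 : γ = β := by
    clear h hkn hln hkn' hln'
    revert α β γ δ; decide
  subst h4
  rw [add_comm (Pi.single α k : Fin 3 → ℤ)] at h
  exact absurd h
    (interior_pair_other_strand hn hab.symm h2 h3 hl hln hk hkn hk' hkn' hl' hln')

/-! ### Sliding chips along strands -/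

theorem vertexClass_zero (α : Fin 3) :
    vertexClass n α 0 = (thetaGraph n).toPic (chip (Sum.inl false)) := by
  rw [vertexClass, thetaVertex_zero]

theorem vertexClass_last (hn : ∀ α, 0 < n α) (α : Fin 3) :
    vertexClass n α (n α) = (thetaGraph n).toPic (chip (Sum.inl true)) := by
  rw [vertexClass, thetaVertex_last hn]

/-- Two chips on one strand may move by equal distances in opposite directions. -/
theorem vertexClass_add_eq (hn : ∀ α, 0 < n α) {α : Fin 3} {i k j l : ℕ} (hi : i ≤ n α)
    (hk : k ≤ n α) (hj : j ≤ n α) (hl : l ≤ n α) (h : i + k = j + l) :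
    vertexClass n α i + vertexClass n α k = vertexClass n α j + vertexClass n α l := by
  rw [vertexClass_eq hn hi, vertexClass_eq hn hk, vertexClass_eq hn hj, vertexClass_eq hn hl]
  have h1 : (i : ℤ) • strandClass n α + (k : ℤ) • strandClass n α =
      (j : ℤ) • strandClass n α + (l : ℤ) • strandClass n α := by
    rw [← add_zsmul, ← add_zsmul]
    congr 1
    exact_mod_cast h
  rw [add_add_add_comm, h1, add_add_add_comm]

/-- Moving all three chips by `s` towards `v_{0,0}` changes the class by `s` times the sum of the
strand classes, which is zero. -/
theorem sum_vertexClass_sub (hn : ∀ α, 0 < n α) {k : Fin 3 → ℕ} (hk : ∀ α, k α ≤ n α) {s : ℕ}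
    (hs : ∀ α, s ≤ k α) :
    ∑ α, vertexClass n α (k α - s) = ∑ α, vertexClass n α (k α) := by
  have h1 : ∀ α, vertexClass n α (k α - s) =
      vertexClass n α (k α) - (s : ℤ) • strandClass n α := by
    intro α
    rw [vertexClass_eq hn (hk α), vertexClass_eq hn ((Nat.sub_le _ _).trans (hk α)),
      Nat.cast_sub (hs α), sub_zsmul]
    abel
  rw [Finset.sum_congr rfl fun α _ => h1 α, Finset.sum_sub_distrib, Finset.sum_zsmul,
    Fin.sum_univ_three (strandClass n), sum_strandClass hn]
  simp

/-! ### Effectivity in degree at least two -/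

/-- The class of three chips, on three vertices taken from the three strands, dominates `v_{0,0}`. -/
theorem hasEffective_sum_strands (hn : ∀ α, 0 < n α) {k : Fin 3 → ℕ} (hk : ∀ α, k α ≤ n α) :
    (thetaGraph n).HasEffective
      ((∑ α, chip (thetaVertex n α (k α))) - chip (Sum.inl false)) := by
  -- Slide by the smallest distance: the chip on strand `m` arrives at `v_{0,0}` and is removed.
  obtain ⟨m, hm⟩ := Finite.exists_min k
  have h := sum_vertexClass_sub hn hk hm
  refine hasEffective_iff.2 ⟨∑ α ∈ Finset.univ.erase m, chip (thetaVertex n α (k α - k m)),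
    Finset.sum_nonneg fun α _ => chip_nonneg _, ?_⟩
  have h2 := Finset.sum_erase_add Finset.univ (fun α => vertexClass n α (k α - k m))
    (Finset.mem_univ m)
  simp only [Nat.sub_self, vertexClass_zero] at h2
  have h3 : ∀ (t : Finset (Fin 3)) (f : Fin 3 → ThetaVertex n → ℤ),
      (thetaGraph n).toPic (∑ α ∈ t, f α) = ∑ α ∈ t, (thetaGraph n).toPic (f α) :=
    fun t f => map_sum (QuotientAddGroup.mk' (thetaGraph n).principal.range) f t
  rw [toPic_sub, h3, h3, ← h, ← h2]
  exact add_sub_cancel_right _ _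

theorem hasEffective_sub_of_distinct (hn : ∀ α, 0 < n α) {α β γ : Fin 3} (hab : α ≠ β)
    (hac : γ ≠ α) (hbc : γ ≠ β) {i k l : ℕ} (hi : i ≤ n α) (hk : k ≤ n β) (hl : l ≤ n γ) :
    (thetaGraph n).HasEffective (chip (thetaVertex n α i) + chip (thetaVertex n β k) +
      chip (thetaVertex n γ l) - chip (Sum.inl false)) := by
  have h := hasEffective_sum_strands hn (k := fun δ => if δ = α then i else if δ = β then k else l)
    (fun δ => by
      split_ifs with h1 h2
      · rwa [h1]
      · rwa [h2]
      · have : δ = γ := by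
          clear hi hk hl
          revert α β γ δ; decide
        rwa [this])
  rw [sum_fin_three hab hac hbc] at h
  simpa [hab.symm, hac, hbc] using h

/-- The last vertex lies on every strand, so its two chips can be assigned to the two strands not
used for `w`. -/
theorem hasEffective_sub_last_last (hn : ∀ α, 0 < n α) (w : ThetaVertex n) :
    (thetaGraph n).HasEffective (chip (Sum.inl true) + chip (Sum.inl true) + chip w -
      chip (Sum.inl false)) := by
  obtain ⟨γ, l, hl, rfl⟩ := exists_eq_thetaVertex hn w
  obtain ⟨α, ha⟩ := exists_ne γ
  obtain ⟨β, hb, hb'⟩ := exists_third γ α ha.symm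
  have := hasEffective_sub_of_distinct hn hb'.symm ha.symm hb.symm le_rfl le_rfl hl
  rwa [thetaVertex_last hn, thetaVertex_last hn] at this

/-- Two chips on one strand can be moved until one of them reaches an end. -/
theorem exists_end_add (hn : ∀ α, 0 < n α) {α : Fin 3} {i k : ℕ} (hi : i ≤ n α) (hk : k ≤ n α) :
    ∃ (t : Bool) (m : ℕ), m ≤ n α ∧ vertexClass n α i + vertexClass n α k =
      (thetaGraph n).toPic (chip (Sum.inl t)) + vertexClass n α m := by
  rcases le_total (i + k) (n α) with h | h
  · refine ⟨false, i + k, h, ?_⟩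
    rw [← vertexClass_zero α]
    exact vertexClass_add_eq hn hi hk (Nat.zero_le _) h (by omega)
  · refine ⟨true, i + k - n α, by omega, ?_⟩
    rw [← vertexClass_last hn α]
    exact vertexClass_add_eq hn hi hk le_rfl (by omega) (by omega)

theorem hasEffective_first_add_sub (w x : ThetaVertex n) :
    (thetaGraph n).HasEffective (chip (Sum.inl false) + chip w + chip x -
      chip (Sum.inl false)) := by
  rw [add_assoc, add_sub_cancel_left]
  exact .of_nonneg (add_nonneg (chip_nonneg _) (chip_nonneg _))

/-- If the other two chips share a strand, slide them until one reaches an end, leaving either a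
chip on `v_{0,0}` or two on the last vertex. Otherwise count the last vertex on the third strand. -/
theorem hasEffective_sub_last (hn : ∀ α, 0 < n α) (w x : ThetaVertex n) :
    (thetaGraph n).HasEffective (chip (Sum.inl true) + chip w + chip x -
      chip (Sum.inl false)) := by
  obtain ⟨α, i, hi, rfl⟩ := exists_eq_thetaVertex hn w
  obtain ⟨β, k, hk, rfl⟩ := exists_eq_thetaVertex hn x
  by_cases hab : α = β
  · subst hab
    obtain ⟨t, m, hm, h⟩ := exists_end_add hn hi hk
    have h1 : (thetaGraph n).toPic (chip (Sum.inl true) + chip (thetaVertex n α i) +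
        chip (thetaVertex n α k) - chip (Sum.inl false)) = (thetaGraph n).toPic
        (chip (Sum.inl t) + chip (Sum.inl true) + chip (thetaVertex n α m) -
          chip (Sum.inl false)) := by
      simp only [toPic_add, toPic_sub]
      rw [add_assoc, h]
      abel
    rw [hasEffective_congr h1]
    cases t
    · exact hasEffective_first_add_sub _ _
    · exact hasEffective_sub_last_last hn _
  · obtain ⟨γ, h', h''⟩ := exists_third α β hab
    have := hasEffective_sub_of_distinct hn h' h''.symm (Ne.symm hab) le_rfl hi hk
    rwa [thetaVertex_last hn] at this

/-- Every class with three chips dominates the vertex `v_{0,0}`. -/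
theorem hasEffective_three_sub (hn : ∀ α, 0 < n α) (w x y : ThetaVertex n) :
    (thetaGraph n).HasEffective (chip w + chip x + chip y - chip (Sum.inl false)) := by
  have same : ∀ {α : Fin 3} {i k : ℕ}, i ≤ n α → k ≤ n α → ∀ z : ThetaVertex n,
      (thetaGraph n).HasEffective (chip (thetaVertex n α i) + chip (thetaVertex n α k) +
        chip z - chip (Sum.inl false)) := by
    intro α i k hi hk z
    obtain ⟨t, m, hm, h⟩ := exists_end_add hn hi hk
    have h1 : (thetaGraph n).toPic (chip (thetaVertex n α i) + chip (thetaVertex n α k) +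
        chip z - chip (Sum.inl false)) = (thetaGraph n).toPic
        (chip (Sum.inl t) + chip (thetaVertex n α m) + chip z - chip (Sum.inl false)) := by
      simp only [toPic_add, toPic_sub, h]
    rw [hasEffective_congr h1]
    cases t
    · exact hasEffective_first_add_sub _ _
    · exact hasEffective_sub_last hn _ _
  obtain ⟨α, i, hi, rfl⟩ := exists_eq_thetaVertex hn w
  obtain ⟨β, k, hk, rfl⟩ := exists_eq_thetaVertex hn x
  obtain ⟨γ, l, hl, rfl⟩ := exists_eq_thetaVertex hn y
  by_cases hab : α = β
  · subst hab
    exact same hi hk _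
  by_cases hac : γ = α
  · subst hac
    rw [add_right_comm]
    exact same hi hl _
  by_cases hbc : γ = β
  · subst hbc
    rw [add_rotate]
    exact same hk hl _
  exact hasEffective_sub_of_distinct hn hab hac hbc hi hk hl

theorem HasEffective.sub_first (hn : ∀ α, 0 < n α) {D : ThetaVertex n → ℤ}
    (h : (thetaGraph n).HasEffective D) (hd : 3 ≤ deg D) :
    (thetaGraph n).HasEffective (D - chip (Sum.inl false)) := by
  obtain ⟨F, hF, e⟩ := hasEffective_iff.1 h
  have hd' : 3 ≤ deg F := by rwa [← deg_eq_of_toPic_eq e]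
  obtain ⟨w, F, hF₁, rfl⟩ := exists_eq_add_chip hF (by omega)
  rw [deg_add, deg_chip] at hd'
  obtain ⟨x, F, hF', rfl⟩ := exists_eq_add_chip hF₁ (by omega)
  rw [deg_add, deg_chip] at hd'
  obtain ⟨y, F, hF'', rfl⟩ := exists_eq_add_chip hF' (by omega)
  have h1 := (HasEffective.of_nonneg (G := thetaGraph n) hF'').add (hasEffective_three_sub hn y x w)
  refine (hasEffective_congr ?_).2 h1
  rw [toPic_sub, e, ← toPic_sub]
  congr 1
  abel

/-- The classes that become effective after adding multiples of `v_{0,0}`. -/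
def effectiveSubFirst (n : Fin 3 → ℕ) : AddSubmonoid (thetaGraph n).Pic where
  carrier := {p | ∃ (F : ThetaVertex n → ℤ) (N : ℕ), 0 ≤ F ∧
    p = (thetaGraph n).toPic F - N • (thetaGraph n).toPic (chip (Sum.inl false))}
  zero_mem' := ⟨0, 0, le_rfl, by simp⟩
  add_mem' := by
    rintro p q ⟨F, N, hF, rfl⟩ ⟨F', N', hF', rfl⟩
    refine ⟨F + F', N + N', add_nonneg hF hF', ?_⟩
    rw [toPic_add, add_nsmul]
    abel

theorem toPic_chip_mem (w : ThetaVertex n) :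
    (thetaGraph n).toPic (chip w) ∈ effectiveSubFirst n :=
  ⟨chip w, 0, chip_nonneg w, by simp⟩

theorem neg_first_mem : -(thetaGraph n).toPic (chip (Sum.inl false)) ∈ effectiveSubFirst n :=
  ⟨0, 1, le_rfl, by simp⟩

theorem strandClass_mem (α : Fin 3) : strandClass n α ∈ effectiveSubFirst n := by
  rw [strandClass, sub_eq_add_neg, vertexClass_zero]
  exact add_mem (toPic_chip_mem _) neg_first_mem

/-- The negative of one strand class is the sum of the other two. -/
theorem neg_strandClass_mem (hn : ∀ α, 0 < n α) (α : Fin 3) :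
    -strandClass n α ∈ effectiveSubFirst n := by
  obtain ⟨β, hb⟩ := exists_ne α
  obtain ⟨γ, h', h''⟩ := exists_third α β hb.symm
  have h := sum_strandClass hn
  rw [← Fin.sum_univ_three, sum_fin_three hb.symm h' h'', add_assoc] at h
  rw [neg_eq_of_add_eq_zero_right h]
  exact add_mem (strandClass_mem _) (strandClass_mem _)

theorem neg_toPic_chip_mem (hn : ∀ α, 0 < n α) (w : ThetaVertex n) :
    -(thetaGraph n).toPic (chip w) ∈ effectiveSubFirst n := by
  obtain ⟨α, k, hk, rfl⟩ := exists_eq_thetaVertex hn w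
  have h : -vertexClass n α k =
      -(thetaGraph n).toPic (chip (Sum.inl false)) + k • (-strandClass n α) := by
    rw [vertexClass_eq hn hk, neg_add, natCast_zsmul, neg_nsmul]
  rw [h]
  exact add_mem neg_first_mem (nsmul_mem (neg_strandClass_mem hn α) k)

/-- Vertex classes generate the Picard group, and the submonoid contains them and their negatives.
-/
theorem mem_effectiveSubFirst (hn : ∀ α, 0 < n α) (D : ThetaVertex n → ℤ) :
    (thetaGraph n).toPic D ∈ effectiveSubFirst n := by
  have h : (thetaGraph n).toPic D = ∑ w, D w • (thetaGraph n).toPic (chip w) := by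
    have h1 : D = ∑ w, D w • chip w := by
      funext x
      simp [Finset.sum_apply, chip, Pi.single_apply]
    conv_lhs => rw [h1]
    refine (map_sum (QuotientAddGroup.mk' (thetaGraph n).principal.range) _ _).trans ?_
    rfl
  rw [h]
  refine sum_mem fun w _ => ?_
  obtain ⟨m, hm | hm⟩ := (D w).eq_nat_or_neg
  · rw [hm, natCast_zsmul]
    exact nsmul_mem (toPic_chip_mem w) m
  · rw [hm, neg_zsmul, natCast_zsmul, ← neg_nsmul]
    exact nsmul_mem (neg_toPic_chip_mem hn w) m

/-- On a theta graph every divisor of degree at least two has an effective representative. -/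
theorem hasEffective_of_two_le_deg (hn : ∀ α, 0 < n α) {D : ThetaVertex n → ℤ}
    (hd : 2 ≤ deg D) : (thetaGraph n).HasEffective D := by
  obtain ⟨F, N, hF, h⟩ := mem_effectiveSubFirst hn D
  induction N generalizing D with
  | zero => exact hasEffective_iff.2 ⟨F, hF, by simpa using h⟩
  | succ N ih =>
    -- Adding `v_{0,0}` lowers `N` by one and raises the degree to at least 3, which is exactly what
    -- allows the chip to be taken off again.
    have h1 := ih (D := D + chip (Sum.inl false)) (by rw [deg_add, deg_chip]; omega)
      (by rw [toPic_add, h, succ_nsmul]; abel)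
    have h2 := HasEffective.sub_first hn h1 (by rw [deg_add, deg_chip]; omega)
    rwa [add_sub_cancel_right] at h2

/-! ### The canonical class and equivalent pairs of vertices -/

/-- The canonical divisor of the theta graph. -/
def canonical (n : Fin 3 → ℕ) : ThetaVertex n → ℤ := chip (Sum.inl false) + chip (Sum.inl true)

@[simp] theorem deg_canonical : deg (canonical n) = 2 := by
  rw [canonical, deg_add, deg_chip, deg_chip]; norm_num

theorem vertexClass_add_eq_canonical (hn : ∀ α, 0 < n α) {α : Fin 3} {i k : ℕ} (hi : i ≤ n α)
    (hk : k ≤ n α) (h : i + k = n α) :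
    vertexClass n α i + vertexClass n α k = (thetaGraph n).toPic (canonical n) := by
  rw [vertexClass_add_eq hn hi hk (Nat.zero_le _) le_rfl (by omega), vertexClass_zero,
    vertexClass_last hn]
  rfl

/-- Two vertices lie on one strand, or in the interiors of two different strands. -/
theorem common_strand_or_interior (hn : ∀ α, 0 < n α) (w x : ThetaVertex n) :
    (∃ α i k, i ≤ n α ∧ k ≤ n α ∧ w = thetaVertex n α i ∧ x = thetaVertex n α k) ∨
    ∃ α β i k, α ≠ β ∧ 0 < i ∧ i < n α ∧ 0 < k ∧ k < n β ∧ w = thetaVertex n α i ∧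
      x = thetaVertex n β k := by
  -- An end of a strand can be relabelled as a vertex of any other strand.
  have ends : ∀ {α : Fin 3} {i : ℕ} (β : Fin 3), i ≤ n α → i = 0 ∨ i = n α →
      ∃ k, k ≤ n β ∧ thetaVertex n α i = thetaVertex n β k := by
    rintro α i β hi (rfl | rfl)
    · exact ⟨0, Nat.zero_le _, by rw [thetaVertex_zero, thetaVertex_zero]⟩
    · exact ⟨n β, le_rfl, by rw [thetaVertex_last hn, thetaVertex_last hn]⟩
  obtain ⟨α, i, hi, rfl⟩ := exists_eq_thetaVertex hn w
  obtain ⟨β, k, hk, rfl⟩ := exists_eq_thetaVertex hn x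
  by_cases h1 : i = 0 ∨ i = n α
  · obtain ⟨j, hj, e⟩ := ends β hi h1
    exact Or.inl ⟨β, j, k, hj, hk, e, rfl⟩
  by_cases h2 : k = 0 ∨ k = n β
  · obtain ⟨j, hj, e⟩ := ends α hk h2
    exact Or.inl ⟨α, i, j, hi, hj, rfl, e⟩
  by_cases hab : α = β
  · subst hab
    exact Or.inl ⟨α, i, k, hi, hk, rfl, rfl⟩
  · exact Or.inr ⟨α, β, i, k, hab, by omega, by omega, by omega, by omega, rfl, rfl⟩

/-- Beyond sliding on one strand, the alternatives are the three classes visible from every strand: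
twice the first vertex, the canonical class, twice the last vertex. -/
theorem common_strand_relation (hn : ∀ α, 0 < n α) {α β : Fin 3} {i k j l : ℕ} (hi : i ≤ n α)
    (hk : k ≤ n α) (hj : j ≤ n β) (hl : l ≤ n β)
    (h : vertexClass n α i + vertexClass n α k = vertexClass n β j + vertexClass n β l) :
    α = β ∧ i + k = j + l ∨ i + k = 0 ∧ j + l = 0 ∨ i + k = n α ∧ j + l = n β ∨
      i + k = 2 * n α ∧ j + l = 2 * n β := by
  have h1 := moment_relation hn hi hk hj hl h
  rw [← Pi.single_add, ← Pi.single_add] at h1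
  have h2 := single_sub_single_relation hn (by omega) (by omega) (by omega) (by omega) h1
  omega

theorem interior_ne_common_strand (hn : ∀ α, 0 < n α) {α β γ : Fin 3} {i k j l : ℕ}
    (hab : α ≠ β) (hi : 0 < i) (hi' : i < n α) (hk : 0 < k) (hk' : k < n β) (hj : j ≤ n γ)
    (hl : l ≤ n γ) :
    vertexClass n α i + vertexClass n β k ≠ vertexClass n γ j + vertexClass n γ l := by
  intro h
  have h1 := moment_relation hn hi'.le hk'.le hj hl h
  rw [← Pi.single_add (i := γ)] at h1
  exact interior_pair_not_relation hn hab (by omega) (by omega) (by omega) (by omega) (by omega)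
    (by omega) h1

/-- Distinct equivalent pairs of vertices, apart from the canonical ones, lie on one strand. -/
theorem common_strand_of_toPic_eq (hn : ∀ α, 0 < n α) {u x v y : ThetaVertex n} (huv : u ≠ v)
    (hxv : x ≠ v)
    (h : (thetaGraph n).toPic (chip u + chip x) = (thetaGraph n).toPic (chip v + chip y))
    (hK : (thetaGraph n).toPic (chip u + chip x) ≠ (thetaGraph n).toPic (canonical n)) :
    ∃ α i k j l, i ≤ n α ∧ k ≤ n α ∧ j ≤ n α ∧ l ≤ n α ∧ u = thetaVertex n α i ∧
      x = thetaVertex n α k ∧ v = thetaVertex n α j ∧ y = thetaVertex n α l ∧ i + k = j + l := by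
  rcases common_strand_or_interior hn u x with
    ⟨α, i, k, hi, hk, rfl, rfl⟩ | ⟨α, β, i, k, hab, hi, hi', hk, hk', rfl, rfl⟩ <;>
  rcases common_strand_or_interior hn v y with
    ⟨γ, j, l, hj, hl, rfl, rfl⟩ | ⟨γ, δ, j, l, hcd, hj, hj', hl, hl', rfl, rfl⟩
  · rcases common_strand_relation hn hi hk hj hl h with ⟨rfl, e⟩ | e | e | e
    · exact ⟨α, i, k, j, l, hi, hk, hj, hl, rfl, rfl, rfl, rfl, e⟩
    · refine absurd ((thetaVertex_eq_iff hn hi hj).2 ?_) huv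
      omega
    · exact absurd (vertexClass_add_eq_canonical hn hi hk e.1) hK
    · refine absurd ((thetaVertex_eq_iff hn hi hj).2 ?_) huv
      omega
  · exact absurd h.symm (interior_ne_common_strand hn hcd hj hj' hl hl' hi hk)
  · exact absurd h (interior_ne_common_strand hn hab hi hi' hk hk' hj hl)
  · have h1 := moment_relation hn hi'.le hk'.le hj'.le hl'.le h
    rcases interior_pair_relation hn hab hcd (by omega) (by omega) (by omega) (by omega)
      (by omega) (by omega) (by omega) (by omega) h1 with ⟨rfl, e, -⟩ | ⟨-, -, rfl, e⟩
    · exact absurd (by rw [Nat.cast_injective e]) huv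
    · exact absurd (by rw [Nat.cast_injective e]) hxv

/-- Adding `v_{0,0}` to both sides reduces this to the comparison of pairs. -/
theorem chip_toPic_injective (hn : ∀ α, 0 < n α) {w x : ThetaVertex n}
    (h : (thetaGraph n).toPic (chip w) = (thetaGraph n).toPic (chip x)) : w = x := by
  rcases common_strand_or_interior hn w x with
    ⟨α, i, k, hi, hk, rfl, rfl⟩ | ⟨α, β, i, k, hab, hi, hi', hk, hk', rfl, rfl⟩
  · have h1 := common_strand_relation hn hi (Nat.zero_le _) hk (Nat.zero_le _)
      (congrArg (· + vertexClass n α 0) h)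
    rw [(by omega : i = k)]
  · have h1 : vertexClass n α i + vertexClass n α 0 = vertexClass n β k + vertexClass n β 0 := by
      rw [vertexClass_zero, vertexClass_zero]
      exact congrArg (· + _) h
    have h2 := common_strand_relation hn hi'.le (Nat.zero_le _) hk'.le (Nat.zero_le _) h1
    omega

/-! ### Ranks of divisors on the theta graph -/

instance : Nonempty (ThetaVertex n) := ⟨Sum.inl false⟩

/-- A divisor of degree `g - 1 = 1` without effective representative. -/
theorem not_hasEffective_last_last_sub_first (hn : ∀ α, 0 < n α) :
    ¬ (thetaGraph n).HasEffective
      (chip (Sum.inl true) + chip (Sum.inl true) - chip (Sum.inl false)) := by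
  intro h
  obtain ⟨w, hw⟩ := h.exists_chip (by simp only [deg_sub, deg_add, deg_chip]; norm_num)
  obtain ⟨α, k, hk, rfl⟩ := exists_eq_thetaVertex hn w
  have h1 : vertexClass n α (n α) + vertexClass n α (n α) =
      vertexClass n α 0 + vertexClass n α k := by
    rw [vertexClass_last hn, vertexClass_zero, vertexClass, ← hw, toPic_sub, toPic_add]
    abel
  have := common_strand_relation hn le_rfl le_rfl (Nat.zero_le _) hk h1
  have := hn α
  omega

theorem hasEffective_canonical_sub (hn : ∀ α, 0 < n α) (w : ThetaVertex n) :
    ∃ x, (thetaGraph n).toPic (canonical n - chip w) = (thetaGraph n).toPic (chip x) := by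
  obtain ⟨α, k, hk, rfl⟩ := exists_eq_thetaVertex hn w
  refine ⟨thetaVertex n α (n α - k), ?_⟩
  rw [toPic_sub, ← vertexClass_add_eq_canonical hn hk (Nat.sub_le (n α) k) (by omega)]
  exact add_sub_cancel_left _ _

/-- The two ends suffice: if D is equivalent both to the first vertex plus x and to the last vertex
plus y, comparing strand sums forces x to be the last vertex. -/
theorem toPic_eq_canonical_of_forall (hn : ∀ α, 0 < n α) {D : ThetaVertex n → ℤ}
    (hd : deg D = 2) (h : ∀ w, (thetaGraph n).HasEffective (D - chip w)) :
    (thetaGraph n).toPic D = (thetaGraph n).toPic (canonical n) := by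
  have key : ∀ w, ∃ x, (thetaGraph n).toPic D =
      (thetaGraph n).toPic (chip w) + (thetaGraph n).toPic (chip x) := by
    intro w
    obtain ⟨x, hx⟩ := (h w).exists_chip (by rw [deg_sub, deg_chip, hd]; norm_num)
    exact ⟨x, by rw [← hx, toPic_sub]; abel⟩
  obtain ⟨x, hx⟩ := key (Sum.inl false)
  obtain ⟨y, hy⟩ := key (Sum.inl true)
  obtain ⟨α, i, hi, rfl⟩ := exists_eq_thetaVertex hn x
  obtain ⟨β, k, hk, rfl⟩ := exists_eq_thetaVertex hn y
  have h1 : vertexClass n α 0 + vertexClass n α i =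
      vertexClass n β (n β) + vertexClass n β k := by
    rw [vertexClass_zero, vertexClass_last hn, ← hx, ← hy]
  have h2 := common_strand_relation hn (Nat.zero_le _) hi le_rfl hk h1
  rw [hx, ← vertexClass_zero α]
  refine vertexClass_add_eq_canonical hn (Nat.zero_le _) hi ?_
  have := hn α
  have := hn β
  rcases h2 with ⟨rfl, h2⟩ | h2 | h2 | h2 <;> omega

/-- Positive rank would make all vertices equivalent to D, hence to each other. -/
theorem rank_of_deg_eq_one (hn : ∀ α, 0 < n α) {D : ThetaVertex n → ℤ} (hd : deg D = 1) :
    (thetaGraph n).rank D = 0 ∧ (thetaGraph n).HasEffective D ∨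
      (thetaGraph n).rank D = -1 ∧ ¬ (thetaGraph n).HasEffective D := by
  by_cases h : (thetaGraph n).HasEffective D
  · refine Or.inl ⟨le_antisymm ?_ (rank_nonneg_iff.2 h), h⟩
    by_contra! h1
    have key : ∀ w, (thetaGraph n).toPic D = (thetaGraph n).toPic (chip w) := by
      intro w
      have := (hasEffective_sub_of_le_rank (G := thetaGraph n) (D := D) (chip_nonneg w)
        (by rw [deg_chip]; omega)).toPic_eq_zero (by rw [deg_sub, hd, deg_chip]; norm_num)
      rwa [toPic_sub, sub_eq_zero] at this
    have := chip_toPic_injective hn ((key (Sum.inl false)).symm.trans (key (Sum.inl true)))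
    simp at this
  · exact Or.inr ⟨rank_eq_neg_one h, h⟩

theorem rank_of_deg_eq_two (hn : ∀ α, 0 < n α) {D : ThetaVertex n → ℤ} (hd : deg D = 2) :
    (thetaGraph n).rank D = 1 ∧ (thetaGraph n).toPic D = (thetaGraph n).toPic (canonical n) ∨
      (thetaGraph n).rank D = 0 ∧
        (thetaGraph n).toPic D ≠ (thetaGraph n).toPic (canonical n) := by
  have h0 : 0 ≤ (thetaGraph n).rank D := rank_nonneg_iff.2 (hasEffective_of_two_le_deg hn hd.ge)
  by_cases h : (thetaGraph n).toPic D = (thetaGraph n).toPic (canonical n)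
  · refine Or.inl ⟨le_antisymm ?_ ?_, h⟩
    · by_contra! h1
      -- Rank 2 would make D equivalent to `v_{0,0} + w` for every `w`, hence all vertices
      -- equivalent.
      have key : ∀ w, (thetaGraph n).toPic D =
          (thetaGraph n).toPic (chip (Sum.inl false)) + (thetaGraph n).toPic (chip w) := by
        intro w
        have := (hasEffective_sub_of_le_rank (G := thetaGraph n) (D := D)
          (add_nonneg (chip_nonneg (Sum.inl false)) (chip_nonneg w))
          (by rw [deg_add, deg_chip, deg_chip]; omega)).toPic_eq_zero
            (by rw [deg_sub, hd, deg_add, deg_chip, deg_chip]; norm_num)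
        rwa [toPic_sub, sub_eq_zero, toPic_add] at this
      have := chip_toPic_injective hn
        (add_left_cancel ((key (Sum.inl false)).symm.trans (key (Sum.inl true))))
      simp at this
    · refine le_rank (by norm_num) fun F hF hF1 => ?_
      obtain ⟨w, rfl⟩ := exists_eq_chip hF hF1
      obtain ⟨x, hx⟩ := hasEffective_canonical_sub hn w
      exact hasEffective_iff.2 ⟨chip x, chip_nonneg x, by rw [← hx, toPic_sub, toPic_sub, h]⟩
  · refine Or.inr ⟨le_antisymm ?_ h0, h⟩
    by_contra! h1
    exact h (toPic_eq_canonical_of_forall hn hd fun w =>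
      hasEffective_sub_of_le_rank (chip_nonneg w) (by rw [deg_chip]; omega))

theorem rank_of_three_le_deg (hn : ∀ α, 0 < n α) {D : ThetaVertex n → ℤ} (hd : 3 ≤ deg D) :
    (thetaGraph n).rank D = deg D - 2 := by
  refine le_antisymm ?_ (le_rank (by omega) fun F _ hF =>
    hasEffective_of_two_le_deg hn (by rw [deg_sub]; omega))
  by_contra! h
  -- Choose `F` of degree `deg D - 1` so that `D - F` is equivalent to the noneffective divisor of
  -- degree 1; it refutes rank at least `deg D - 1`.
  obtain ⟨F, hF, e⟩ := hasEffective_iff.1 (hasEffective_of_two_le_deg hn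
    (D := D - (chip (Sum.inl true) + chip (Sum.inl true) - chip (Sum.inl false)))
    (by simp only [deg_sub, deg_add, deg_chip]; omega))
  have hdF := deg_eq_of_toPic_eq e
  simp only [deg_sub, deg_add, deg_chip] at hdF
  refine not_hasEffective_last_last_sub_first hn
    ((hasEffective_congr ?_).1 (hasEffective_sub_of_le_rank (D := D) hF (by omega)))
  rw [toPic_sub, ← e, toPic_sub, sub_sub_cancel]

/-! ### Divisors with negative Δ -/

/-- In degree 2 only r(D) = r(D - u) = r(D - v) = 0 with r(D - u - v) = -1 makes Δ negative. In
degree 1, at most one of D ~ u and D ~ v holds, and then r(D) ≥ 0 compensates. In degree 3, at most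
one of D - u and D - v is canonical, and then D - u - v is effective. In the remaining degrees the
rank values and r ≥ -1 suffice. -/
theorem delta_neg_iff (hn : ∀ α, 0 < n α) {u v : ThetaVertex n} (huv : u ≠ v)
    (D : ThetaVertex n → ℤ) : (thetaGraph n).Delta u v D < 0 ↔
      deg D = 2 ∧ (thetaGraph n).toPic D ≠ (thetaGraph n).toPic (canonical n) ∧
      (thetaGraph n).toPic D ≠ (thetaGraph n).toPic (chip u + chip v) ∧
      (thetaGraph n).HasEffective (D - chip u) ∧ (thetaGraph n).HasEffective (D - chip v) := by
  have du : deg (D - chip u) = deg D - 1 := by rw [deg_sub, deg_chip]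
  have dv : deg (D - chip v) = deg D - 1 := by rw [deg_sub, deg_chip]
  have duv : deg (D - chip u - chip v) = deg D - 2 := by
    rw [deg_sub, du, deg_chip]; ring
  have m1 := neg_one_le_rank (G := thetaGraph n) (D - chip u)
  have m2 := neg_one_le_rank (G := thetaGraph n) (D - chip v)
  have m3 := neg_one_le_rank (G := thetaGraph n) (D - chip u - chip v)
  have m4 := neg_one_le_rank (G := thetaGraph n) D
  unfold Delta
  rcases (by omega : deg D < 0 ∨ deg D = 0 ∨ deg D = 1 ∨ deg D = 2 ∨ deg D = 3 ∨ deg D = 4 ∨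
    5 ≤ deg D) with h | h | h | h | h | h | h
  · have := rank_of_deg_neg (G := thetaGraph n) (D := D - chip u) (by omega)
    have := rank_of_deg_neg (G := thetaGraph n) (D := D - chip v) (by omega)
    have := rank_of_deg_neg (G := thetaGraph n) (D := D) (by omega)
    omega
  · have := rank_of_deg_neg (G := thetaGraph n) (D := D - chip u) (by omega)
    have := rank_of_deg_neg (G := thetaGraph n) (D := D - chip v) (by omega)
    omega
  · have h1 := rank_of_deg_eq_zero (G := thetaGraph n) (D := D - chip u) (by omega)
    have h2 := rank_of_deg_eq_zero (G := thetaGraph n) (D := D - chip v) (by omega)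
    have h3 := rank_of_deg_neg (G := thetaGraph n) (D := D - chip u - chip v) (by omega)
    rw [toPic_sub, sub_eq_zero] at h1 h2
    have eff : ∀ w, (thetaGraph n).toPic D = (thetaGraph n).toPic (chip w) →
        0 ≤ (thetaGraph n).rank D := fun w hw =>
      rank_nonneg_iff.2 (hasEffective_iff.2 ⟨_, chip_nonneg w, hw⟩)
    have eu := eff u
    have ev := eff v
    have hne : ¬ ((thetaGraph n).toPic D = (thetaGraph n).toPic (chip u) ∧
        (thetaGraph n).toPic D = (thetaGraph n).toPic (chip v)) := fun e =>
      huv (chip_toPic_injective hn (e.1.symm.trans e.2))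
    refine iff_of_false ?_ (by omega)
    rcases h1 with h1 | h1 <;> rcases h2 with h2 | h2
    · exact absurd ⟨h1.2, h2.2⟩ hne
    · have := eu h1.2
      omega
    · have := ev h2.2
      omega
    · omega
  · have h1 := rank_of_deg_eq_one hn (D := D - chip u) (by omega)
    have h2 := rank_of_deg_eq_one hn (D := D - chip v) (by omega)
    have h3 := rank_of_deg_eq_zero (G := thetaGraph n) (D := D - chip u - chip v) (by omega)
    rw [sub_sub, toPic_sub, sub_eq_zero, sub_ne_zero, ← sub_sub] at h3
    have h4 := rank_of_deg_eq_two hn h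
    have h5 : (thetaGraph n).toPic D = (thetaGraph n).toPic (chip u + chip v) →
        (thetaGraph n).HasEffective (D - chip u) ∧ (thetaGraph n).HasEffective (D - chip v) := by
      intro e
      constructor
      · exact hasEffective_iff.2 ⟨chip v, chip_nonneg v, by
          rw [toPic_sub, e, toPic_add]; abel⟩
      · exact hasEffective_iff.2 ⟨chip u, chip_nonneg u, by
          rw [toPic_sub, e, toPic_add]; abel⟩
    rcases h1 with ⟨h1, e1⟩ | ⟨h1, e1⟩ <;> rcases h2 with ⟨h2, e2⟩ | ⟨h2, e2⟩ <;>
    rcases h3 with ⟨h3, e3⟩ | ⟨h3, e3⟩ <;> rcases h4 with ⟨h4, e4⟩ | ⟨h4, e4⟩ <;>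
    first
      | exact iff_of_false (by omega) (by tauto)
      | exact iff_of_true (by omega) (by tauto)
  · have h1 := rank_of_deg_eq_two hn (D := D - chip u) (by omega)
    have h2 := rank_of_deg_eq_two hn (D := D - chip v) (by omega)
    have h3 := rank_of_three_le_deg hn (D := D) (by omega)
    have c1 : ∀ w x : ThetaVertex n,
        (thetaGraph n).toPic (D - chip w) = (thetaGraph n).toPic (canonical n) →
        0 ≤ (thetaGraph n).rank (D - chip w - chip x) := by
      intro w x e
      obtain ⟨y, hy⟩ := hasEffective_canonical_sub hn x
      exact rank_nonneg_iff.2 (hasEffective_iff.2 ⟨chip y, chip_nonneg y, by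
        rw [← hy, toPic_sub, e, toPic_sub]⟩)
    have cu := c1 u v
    have cv := c1 v u
    rw [sub_right_comm] at cv
    have hne : ¬ ((thetaGraph n).toPic (D - chip u) = (thetaGraph n).toPic (canonical n) ∧
        (thetaGraph n).toPic (D - chip v) = (thetaGraph n).toPic (canonical n)) := fun e =>
      huv (chip_toPic_injective hn (sub_right_inj (a := (thetaGraph n).toPic D)
        |>.1 (e.1.trans e.2.symm)))
    refine iff_of_false ?_ (by omega)
    rcases h1 with h1 | h1 <;> rcases h2 with h2 | h2
    · exact absurd ⟨h1.2, h2.2⟩ hne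
    · have := cu h1.2
      omega
    · have := cv h2.2
      omega
    · omega
  · have h1 := rank_of_three_le_deg hn (D := D - chip u) (by omega)
    have h2 := rank_of_three_le_deg hn (D := D - chip v) (by omega)
    have h3 := rank_of_three_le_deg hn (D := D) (by omega)
    have h4 := rank_of_deg_eq_two hn (D := D - chip u - chip v) (by omega)
    omega
  · have h1 := rank_of_three_le_deg hn (D := D - chip u) (by omega)
    have h2 := rank_of_three_le_deg hn (D := D - chip v) (by omega)
    have h3 := rank_of_three_le_deg hn (D := D) (by omega)
    have h4 := rank_of_three_le_deg hn (D := D - chip u - chip v) (by omega)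
    omega

/-- The vertices of `nonSubmodularSet` are the `x` such that `u + x` has negative `Δ`. -/
theorem delta_neg_iff_exists (hn : ∀ α, 0 < n α) {u v : ThetaVertex n} (huv : u ≠ v)
    (D : ThetaVertex n → ℤ) : (thetaGraph n).Delta u v D < 0 ↔
      ∃ α i j, i ≤ n α ∧ j ≤ n α ∧ u = thetaVertex n α i ∧ v = thetaVertex n α j ∧
        ∃ w ∈ nonSubmodularSet n α i j,
          (thetaGraph n).toPic D = (thetaGraph n).toPic (chip w + chip u) := by
  rw [delta_neg_iff hn huv]
  constructor
  · rintro ⟨hd, hK, huvD, hu, hv⟩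
    obtain ⟨x, hx⟩ := hu.exists_chip (by rw [deg_sub, deg_chip, hd]; norm_num)
    obtain ⟨y, hy⟩ := hv.exists_chip (by rw [deg_sub, deg_chip, hd]; norm_num)
    rw [toPic_sub, sub_eq_iff_eq_add', ← toPic_add] at hx hy
    have hxv : x ≠ v := by
      rintro rfl
      exact huvD hx
    obtain ⟨α, i, k, j, l, hi, hk, hj, hl, rfl, rfl, rfl, rfl, e⟩ :=
      common_strand_of_toPic_eq hn huv hxv (hx.symm.trans hy) (by rwa [← hx])
    refine ⟨α, i, j, hi, hj, rfl, rfl, _, ⟨k, hk, rfl, ?_, ?_, by omega, by omega⟩,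
      by rw [hx, add_comm]⟩
    · intro h
      exact hK (hx.trans (vertexClass_add_eq_canonical hn hi hk (by omega)))
    · rintro rfl
      exact hxv rfl
  · rintro ⟨α, i, j, hi, hj, rfl, rfl, _, ⟨k, hk, rfl, h1, h2, h3, h4⟩, hD⟩
    have hD' : (thetaGraph n).toPic D = vertexClass n α k + vertexClass n α i := hD
    refine ⟨?_, ?_, ?_, ?_, ?_⟩
    · rw [deg_eq_of_toPic_eq hD, deg_add, deg_chip, deg_chip]; norm_num
    · intro e
      have h5 : vertexClass n α k + vertexClass n α i =
          vertexClass n α 0 + vertexClass n α (n α) := by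
        rw [← hD', e, vertexClass_add_eq_canonical hn (Nat.zero_le _) le_rfl (by omega)]
      have := common_strand_relation hn hk hi (Nat.zero_le _) le_rfl h5
      have := hn α
      omega
    · intro e
      have h5 : vertexClass n α k = vertexClass n α j := by
        rw [hD', toPic_add, add_comm] at e
        exact add_left_cancel e
      exact h2 (thetaVertex_injOn hn hk hj (chip_toPic_injective hn h5))
    · exact hasEffective_iff.2 ⟨_, chip_nonneg (thetaVertex n α k), by
        rw [toPic_sub, hD']; exact add_sub_cancel_right _ _⟩
    -- Sliding the chip at `i` to `j` moves the one at `k` to `k + i - j`; the two bounds on `k`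
    -- keep it on the strand and make the natural subtraction exact.
    · refine hasEffective_iff.2 ⟨_, chip_nonneg (thetaVertex n α (k + i - j)), ?_⟩
      rw [toPic_sub, hD', vertexClass_add_eq hn hk hi hj (by omega : k + i - j ≤ n α) (by omega)]
      exact add_sub_cancel_left _ _

end ThetaGraph

/-! ### The theorem -/

open ThetaGraph in
theorem mainTheorem4 (n : Fin 3 → ℕ) (hn : ∀ α, 0 < n α) (u v : ThetaVertex n)
    (huv : ¬ (thetaGraph n).LinEquiv (Multigraph.chip u) (Multigraph.chip v)) :
    ((∃ D : ThetaVertex n → ℤ, (thetaGraph n).Delta u v D < 0) ↔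
      ∃ (α : Fin 3) (i j : ℕ), i ≤ n α ∧ j ≤ n α ∧
        u = thetaVertex n α i ∧ v = thetaVertex n α j ∧ (nonSubmodularSet n α i j).Nonempty) ∧
    ∀ (α : Fin 3) (i j : ℕ), i ≤ n α → j ≤ n α →
      u = thetaVertex n α i → v = thetaVertex n α j →
      Set.BijOn
        (fun w => (thetaGraph n).toPic (Multigraph.chip w + Multigraph.chip (thetaVertex n α i)))
        (nonSubmodularSet n α i j)
        {c | ∃ D : ThetaVertex n → ℤ, (thetaGraph n).toPic D = c ∧
          (thetaGraph n).Delta u v D < 0} := by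
  have hne : u ≠ v := by
    rintro rfl
    exact huv (Multigraph.linEquiv_iff.2 rfl)
  refine ⟨⟨?_, ?_⟩, ?_⟩
  · rintro ⟨D, hD⟩
    obtain ⟨α, i, j, hi, hj, hu, hv, w, hw, -⟩ := (delta_neg_iff_exists hn hne D).1 hD
    exact ⟨α, i, j, hi, hj, hu, hv, w, hw⟩
  · rintro ⟨α, i, j, hi, hj, hu, hv, w, hw⟩
    exact ⟨_, (delta_neg_iff_exists hn hne _).2 ⟨α, i, j, hi, hj, hu, hv, w, hw, rfl⟩⟩
  · intro α i j hi hj hu hv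
    refine ⟨fun w hw => ?_, fun w _ x _ h => ?_, ?_⟩
    · exact ⟨_, rfl, (delta_neg_iff_exists hn hne _).2
        ⟨α, i, j, hi, hj, hu, hv, w, hw, by rw [hu]⟩⟩
    · simp only [Multigraph.toPic_add] at h
      exact chip_toPic_injective hn (add_right_cancel h)
    · rintro _ ⟨D, rfl, hD⟩
      obtain ⟨β, i', j', hi', hj', hu', hv', w, hw, e⟩ := (delta_neg_iff_exists hn hne D).1 hD
      rw [hu] at e
      refine ⟨w, ?_, e.symm⟩
      have h1 := (thetaVertex_eq_iff hn hi hi').1 (hu.symm.trans hu')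
      have h2 := (thetaVertex_eq_iff hn hj hj').1 (hv.symm.trans hv')
      by_cases hab : α = β
      · subst hab
        rwa [(by omega : i = i'), (by omega : j = j')]
      -- Vertices lying on two strands are ends, so u and v are the two different ends. The bounds
      -- then leave only `k = n β - i'`, the excluded canonical class, and the set is empty.
      · exfalso
        obtain ⟨k, hk, -, h3, h4, h5, h6⟩ := hw
        have h7 : ¬ (i' = 0 ∧ j' = 0) := fun h =>
          hne (by rw [hu', hv', h.1, h.2])
        have h8 : ¬ (i' = n β ∧ j' = n β) := fun h =>
          hne (by rw [hu', hv', h.1, h.2])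
        omega
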